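/- A \emph{pathograph} $\mathfrak H=(V,U,E,S,R,\pi)$ consists of finite sets $V$ (vertices) and $U$ (urpaths), a set $E\subseteq\binom V2$ of edges, a set $S\subseteq V\times U$ of spokes, a set $R\subseteq\binom U2$ of rungs, and a map $\pi:U\to\binom V2$ assigning to each urpath its two (distinct) endpoints, where the endpoints of an urpath are never joined by an edge. For each $u\in U$ call one of the two elements of $\pi(u)$ the left endpoint $a_u$ and the other the right endpoint $b_u$. A \emph{realization} of $\mathfrak H$ is a (finite, simple) graph $G$ whose vertex set is the disjoint union of $V$ and, for each $u\in U$, a set $\{x_u^{(1)},\dots,x_u^{(m_u)}\}$ with $m_u\ge1$, such that: (i) two elements of $V$ are adjacent in $G$ if and only if they form an edge in $E$; (ii) $a_u x_u^{(1)}\cdots x_u^{(m_u)} b_u$ is an induced path of $G$ for each $u\in U$; (iii) if $(v,u)\in S$, then $v$ is adjacent to some $x_u^{(k)}$; if $(v,u)\notin S$ and $v\notin\pi(u)$, then $v$ is adjacent to no $x_u^{(k)}$; (iv) for distinct $u,u'\in U$, if $\{u,u'\}\in R$ then some $x_u^{(k)}$ is adjacent to some $x_{u'}^{(\ell)}$,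 and if $\{u,u'\}\notin R$ then no $x_u^{(k)}$ is adjacent to any $x_{u'}^{(\ell)}$. A graph is \emph{$\mathcal F$-free}, for a set $\mathcal F$ of pathographs, if none of its induced subgraphs is isomorphic to a realization of a member of $\mathcal F$. Let the urpaths of $\mathfrak H$ be enumerated as $u_1,\dots,u_K$, and fix left and right endpoints for each of them. The \emph{determination string} of a realization $G$ of $\mathfrak H$ is the string over the alphabet $\Sigma=\{1,\dots,K\}\times 2^{V}$ obtained by concatenating, for $i=1,\dots,K$ in order and then for $j=1,\dots,m_{u_i}$ in order, the symbols $\bigl(i,\;N_G(x_{u_i}^{(j)})\cap V\bigr)$. \textbf{Theorem.} Let $\mathfrak H$ be a pathograph with no rungs, with any enumeration of its urpaths and any choice of left and right endpoints, and let $\mathcal F$ be a finite set of pathographs. Then there is a deterministic finite automaton $M$ over the alphabet $\Sigma$ that accepts a string $\sigma\in\Sigma^*$ if and only if $\sigma$ is the determination string of an $\mathcal F$-free realization of $\mathfrak H$. -/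

import Mathlib

universe u w

/-- A pathograph `(V, U, E, S, R, π)`. The vertex set and the set of urpaths are finite. -/
structure Pathograph where
  /-- The vertices. -/
  V : Type u
  /-- The urpaths. -/
  U : Type u
  finite_V : Finite V
  finite_U : Finite U
  /-- The edges. -/
  edge : SimpleGraph V
  /-- The spokes, a relation between vertices and urpaths. -/
  spoke : V → U → Prop
  /-- The rungs, a set of unordered pairs of distinct urpaths. -/
  rung : SimpleGraph U
  /-- The two endpoints of each urpath. -/
  ends : U → Sym2 V
  ends_ne : ∀ p, ¬ (ends p).IsDiag
  ends_nonadj : ∀ p, ends p ∉ edge.edgeSet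

namespace Pathograph

/-- A choice, for every urpath, of which endpoint is the left one and which is the right one. -/
structure Orientation (H : Pathograph.{u}) where
  left : H.U → H.V
  right : H.U → H.V
  ends_eq : ∀ p, H.ends p = s(left p, right p)

/-- The vertices of a realization in which urpath `p` is replaced by a path with `len p` internal
vertices: the vertices of `H` (as `Sum.inl v`) and the internal vertices (as `Sum.inr ⟨p, k⟩`). -/
abbrev RealizationVertex (H : Pathograph.{u}) (len : H.U → ℕ) : Type u :=
  H.V ⊕ (Σ p : H.U, Fin (len p))

/-- The sequence `a, x₁, …, x_m, b` of vertices of the path that replaces the urpath `p`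
with left endpoint `a` and right endpoint `b`. -/
def pathSeq {H : Pathograph.{u}} (o : H.Orientation) (len : H.U → ℕ) (p : H.U) :
    Fin (len p + 1 + 1) → H.RealizationVertex len :=
  Fin.cons (Sum.inl (o.left p))
    (Fin.snoc (α := fun _ => H.RealizationVertex len)
      (fun k : Fin (len p) => Sum.inr ⟨p, k⟩) (Sum.inl (o.right p)))

/-- A realization of `H`, the path replacing each urpath being listed from its left endpoint to its
right endpoint. Up to renaming the internal vertices, every realization has this form. -/
structure Realization (H : Pathograph.{u}) (o : H.Orientation) where
  /-- The number of internal vertices of the path that replaces each urpath. -/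
  len : H.U → ℕ
  one_le_len : ∀ p, 1 ≤ len p
  graph : SimpleGraph (H.RealizationVertex len)
  /-- The vertices and edges of `H` are preserved. -/
  adj_vertex : ∀ v v' : H.V, graph.Adj (Sum.inl v) (Sum.inl v') ↔ H.edge.Adj v v'
  /-- Each urpath is replaced by an induced path. -/
  induced_path : ∀ (p : H.U) (i j : Fin (len p + 1 + 1)),
    graph.Adj (pathSeq o len p i) (pathSeq o len p j) ↔
      (SimpleGraph.pathGraph (len p + 1 + 1)).Adj i j
  adj_of_spoke : ∀ (v : H.V) (p : H.U), H.spoke v p →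
    ∃ k : Fin (len p), graph.Adj (Sum.inl v) (Sum.inr ⟨p, k⟩)
  /-- The endpoints of `p` are excepted, since each is adjacent to the next vertex on the path. -/
  not_adj_of_not_spoke : ∀ (v : H.V) (p : H.U), ¬ H.spoke v p → v ∉ H.ends p →
    ∀ k : Fin (len p), ¬ graph.Adj (Sum.inl v) (Sum.inr ⟨p, k⟩)
  adj_of_rung : ∀ p q : H.U, H.rung.Adj p q →
    ∃ (k : Fin (len p)) (l : Fin (len q)), graph.Adj (Sum.inr ⟨p, k⟩) (Sum.inr ⟨q, l⟩)
  not_adj_of_not_rung : ∀ p q : H.U, p ≠ q → ¬ H.rung.Adj p q →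
    ∀ (k : Fin (len p)) (l : Fin (len q)), ¬ graph.Adj (Sum.inr ⟨p, k⟩) (Sum.inr ⟨q, l⟩)

/-- The graph `G` contains `F`: some induced subgraph of `G` is isomorphic to a realization
of `F`. -/
def ContainedIn (F : Pathograph.{w}) {W : Type u} (G : SimpleGraph W) : Prop :=
  ∃ (o : F.Orientation) (R : F.Realization o), Nonempty (R.graph ↪g G)

/-- The graph `G` is `𝓕`-free: it contains no member of `𝓕`. -/
def IsFree (𝓕 : Set Pathograph.{w}) {W : Type u} (G : SimpleGraph W) : Prop :=
  ∀ F ∈ 𝓕, ¬ F.ContainedIn G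

/-- `N(x) ∩ V(H)` for a vertex `x` of a realization of `H`. -/
def Realization.nbhd {H : Pathograph.{u}} {o : H.Orientation} (R : H.Realization o)
    (x : H.RealizationVertex R.len) : Set H.V :=
  {v | R.graph.Adj x (Sum.inl v)}

/-- The determination string of a realization of `H`, where `e` lists the urpaths of `H` as
`u₁, …, u_K`: the concatenation over `i`, and then over the internal vertices `x` of the path
replacing `u_i`, from left to right, of the symbols `(i, N(x) ∩ V(H))`. -/
def Realization.determinationString {H : Pathograph.{u}} {o : H.Orientation} (R : H.Realization o)
    {K : ℕ} (e : Fin K ≃ H.U) : List (Fin K × Set H.V) :=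
  (List.ofFn fun i : Fin K =>
    List.ofFn fun j : Fin (R.len (e i)) => (i, R.nbhd (Sum.inr ⟨e i, j⟩))).flatten

end Pathograph

/-!
The determination strings of realizations of `H` form a regular language, since a determination
string is a concatenation of one block for each urpath, and whether a word is a possible block for a
given urpath is seen from its first, last and consecutive letters and from the letters that occur
(`Pathograph.isRegular_determinationString`). This is where the absence of rungs enters. It enters
again in that the determination string of a realization `R` determines `R.graph`: two internal
vertices are adjacent exactly if they are consecutive positions of the string with the same urpath
index. So `R.graph` is isomorphic to a graph `wordGraph H.edge w` defined for every word `w`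
(`Pathograph.Realization.nonempty_iso_wordGraph`), and it remains to show that the words `w` for
which this graph is `𝓕`-free form a regular language.

For that, containment of a pathograph `F` is expressed by quantification over sets of vertices. An
induced subgraph that is a realization of `F` is described by labelling its vertices by the vertices
and urpaths of `F`. All conditions on the labelling are about the existence of labels, or of
adjacent pairs of labels, except that the vertices labelled by an urpath must be the internal
vertices of an induced path between its endpoints `a`, `b`. The latter holds exactly if they form a
minimal set `X` such that `X ∪ {a, b}` is connected: a shortest path from `a` to `b` in `X ∪ {a, b}`
is induced, and by minimality it uses all of `X` (`SimpleGraph.MinimalConnector.exists_path`).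
Connectedness is a statement about all bipartitions of the vertex set. Thus
`F.ContainedIn (wordGraph E w)` is a property of `w` in monadic second-order logic, and
as in Büchi's theorem such properties are recognizable: Boolean operations are the closure
properties of regular languages, a quantifier over labellings of the positions of a word is
projection of languages (`Recognizable.exists_labelling`), and a labelling of the vertices in `H.V`
is one of finitely many. The formulas are not formalized as syntax. Instead, for each property of
words `w`, its recognizability is shown from that of its constituents.
-/

/-! ### Closure properties of regular languages -/

namespace Language

theorem isRegular_accepts {α σ : Type*} [Finite σ] (M : DFA α σ) : M.accepts.IsRegular :=
  isRegular_iff.2 ⟨σ, Fintype.ofFinite σ, M, rfl⟩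

theorem IsRegular.of_mem_iff {α : Type*} {L L' : Language α} (h : L.IsRegular)
    (hi : ∀ x, x ∈ L' ↔ x ∈ L) : L'.IsRegular := by
  rwa [Language.ext hi]

/-- The subset construction: the automaton follows all preimages of the letters at once. -/
theorem IsRegular.map {α β : Type*} {L : Language α} (h : L.IsRegular) (f : α → β) :
    (Language.map f L).IsRegular := by
  obtain ⟨σ, _, M, rfl⟩ := h
  let N : DFA β (Set σ) :=
    { step := fun S b => {t | ∃ s ∈ S, ∃ a, f a = b ∧ M.step s a = t}
      start := {M.start}
      accept := {S | ∃ s ∈ S, s ∈ M.accept} }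
  have key : ∀ x, N.eval x = {t | ∃ y : List α, y.map f = x ∧ M.eval y = t} := by
    intro x
    induction x using List.reverseRecOn with
    | nil => ext t; simp [N, eq_comm]
    | append_singleton x b ih =>
      rw [DFA.eval_append_singleton, ih]
      ext t
      constructor
      · rintro ⟨s, ⟨y, rfl, rfl⟩, a, rfl, rfl⟩
        exact ⟨y ++ [a], by simp, by simp⟩
      · rintro ⟨y, hy, rfl⟩
        obtain ⟨y₁, y₂, rfl, rfl, h₂⟩ := List.map_eq_append_iff.1 hy
        obtain ⟨a, rfl, rfl⟩ := List.map_eq_singleton_iff.1 h₂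
        exact ⟨_, ⟨y₁, rfl, rfl⟩, a, rfl, by simp⟩
  have : N.accepts = Language.map f M.accepts := by
    ext x
    rw [DFA.mem_accepts, key]
    constructor
    · rintro ⟨_, ⟨y, rfl, rfl⟩, hy⟩
      exact ⟨y, hy, rfl⟩
    · rintro ⟨y, hy, rfl⟩
      exact ⟨_, ⟨y, rfl, rfl⟩, hy⟩
  rw [← this]
  exact isRegular_accepts N

/-- The automaton runs the first factor, and in parallel one copy of the second factor for each
prefix in the first language. -/
theorem IsRegular.mul {α : Type*} {L₁ L₂ : Language α} (h₁ : L₁.IsRegular) (h₂ : L₂.IsRegular) :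
    (L₁ * L₂).IsRegular := by
  obtain ⟨σ, _, M, rfl⟩ := h₁
  obtain ⟨τ, _, N, rfl⟩ := h₂
  let P : DFA α (σ × Set τ) :=
    { step := fun q a => (M.step q.1 a,
        {t | (∃ s ∈ q.2, N.step s a = t) ∨ (M.step q.1 a ∈ M.accept ∧ t = N.start)})
      start := (M.start, {t | M.start ∈ M.accept ∧ t = N.start})
      accept := {q | ∃ s ∈ q.2, s ∈ N.accept} }
  have key : ∀ x, P.eval x =
      (M.eval x, {t | ∃ y z : List α, y ++ z = x ∧ y ∈ M.accepts ∧ N.eval z = t}) := by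
    intro x
    induction x using List.reverseRecOn with
    | nil =>
      ext t
      · rfl
      · simp [P, DFA.mem_accepts, eq_comm]
    | append_singleton x a ih =>
      rw [DFA.eval_append_singleton, ih]
      refine Prod.ext (by simp [P]) ?_
      ext t
      constructor
      · rintro (⟨s, ⟨y, z, rfl, hy, rfl⟩, rfl⟩ | ⟨h, rfl⟩)
        · exact ⟨y, z ++ [a], by simp, hy, by simp⟩
        · exact ⟨x ++ [a], [], by simp, by simpa [DFA.mem_accepts] using h, by simp⟩
      · rintro ⟨y, z, hyz, hy, rfl⟩
        obtain rfl | ⟨z, b, rfl⟩ := List.eq_nil_or_concat z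
        · right
          obtain rfl : y = x ++ [a] := by simpa using hyz
          exact ⟨by simpa [DFA.mem_accepts] using hy, rfl⟩
        · left
          rw [List.concat_eq_append, ← List.append_assoc] at hyz
          obtain ⟨rfl, h⟩ := List.append_inj' hyz rfl
          obtain rfl : b = a := by simpa using h
          exact ⟨_, ⟨y, z, rfl, hy, rfl⟩, by simp⟩
  have : P.accepts = M.accepts * N.accepts := by
    ext x
    rw [DFA.mem_accepts, key, Language.mem_mul]
    constructor
    · rintro ⟨_, ⟨y, z, rfl, hy, rfl⟩, hz⟩
      exact ⟨y, hy, z, hz, rfl⟩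
    · rintro ⟨y, hy, z, hz, rfl⟩
      exact ⟨_, ⟨y, z, rfl, hy, rfl⟩, hz⟩
  rw [← this]
  exact isRegular_accepts P

theorem isRegular_const {α : Type*} (p : Prop) : IsRegular ({_x | p} : Language α) :=
  ⟨Unit, inferInstance, ⟨fun _ _ => (), (), {_s | p}⟩, rfl⟩

theorem isRegular_one {α : Type*} : (1 : Language α).IsRegular := by
  let M : DFA α Prop := ⟨fun _ _ => False, True, {p | p}⟩
  have : M.accepts = 1 := by
    ext x
    rw [DFA.mem_accepts, Language.mem_one]
    cases x using List.reverseRecOn with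
    | nil => simp [M]
    | append_singleton x a => simp [M]
  rw [← this]
  exact isRegular_accepts M

theorem isRegular_singleton {α : Type*} (P : α → Prop) :
    IsRegular ({x | ∃ a, P a ∧ x = [a]} : Language α) := by
  -- The state is `none` before the first letter, and then tells whether the word read so far is a
  -- single letter satisfying `P`.
  let M : DFA α (Option Prop) :=
    ⟨fun s a => some (s = none ∧ P a), none, {s | s = some True}⟩
  have hM : M.accepts = ({x | ∃ a, P a ∧ x = [a]} : Language α) := by
    ext x
    rw [DFA.mem_accepts]
    refine Iff.trans ?_ (b := ∃ a, P a ∧ x = [a]) Iff.rfl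
    cases x using List.reverseRecOn with
    | nil => simp [M]
    | append_singleton x a =>
      cases x using List.reverseRecOn with
      | nil => simp [M]
      | append_singleton x b =>
        rw [DFA.eval_append_singleton, DFA.eval_append_singleton]
        simp only [M, reduceCtorEq, false_and, Set.mem_ofPred_eq, Option.some.injEq,
          List.append_assoc, eq_iff_iff, iff_true, false_iff, not_exists, not_and]
        intro c _ h
        simpa using congrArg List.length h
  rw [← hM]
  exact isRegular_accepts M

theorem isRegular_iUnion {α : Type*} {ι : Type*} [Finite ι] {L : ι → Language α}
    (h : ∀ i, (L i).IsRegular) : IsRegular ({x | ∃ i, x ∈ L i} : Language α) := by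
  have key : ∀ s : Set ι, s.Finite → IsRegular ({x | ∃ i ∈ s, x ∈ L i} : Language α) := by
    intro s hs
    induction s, hs using Set.Finite.induction_on with
    | empty => simpa using isRegular_const (α := α) False
    | @insert i s _ _ ih =>
      refine ((h i).add ih).of_mem_iff fun x => ?_
      change (∃ j ∈ insert i s, x ∈ L j) ↔ (x ∈ L i ∨ ∃ j ∈ s, x ∈ L j)
      simp only [Set.mem_insert_iff, exists_eq_or_imp]
  simpa using key Set.univ Set.finite_univ

/-- The concatenations of one word from each of finitely many regular languages, in order. -/
theorem isRegular_flatten_ofFn {α : Type*} {K : ℕ} (B : Fin K → Language α)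
    (hB : ∀ i, (B i).IsRegular) :
    IsRegular ({x | ∃ b : Fin K → List α, (∀ i, b i ∈ B i) ∧ (List.ofFn b).flatten = x} :
      Language α) := by
  induction K with
  | zero =>
    refine isRegular_one.of_mem_iff fun x => ?_
    rw [Language.mem_one]
    constructor
    · rintro ⟨b, -, rfl⟩
      simp
    · rintro rfl
      exact ⟨Fin.elim0, fun i => i.elim0, by simp⟩
  | succ K ih =>
    refine ((hB 0).mul (ih (fun i => B i.succ) fun i => hB i.succ)).of_mem_iff fun x => ?_
    constructor
    · rintro ⟨b, hb, rfl⟩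
      exact ⟨b 0, hb 0, _, ⟨fun i => b i.succ, fun i => hb i.succ, rfl⟩, by simp⟩
    · rintro ⟨y, hy, _, ⟨b, hb, rfl⟩, rfl⟩
      exact ⟨Fin.cons y b, Fin.cases hy hb, by simp⟩

end Language

/-! ### Recognizable properties of words -/

/-- A property of words `w : Fin n → α` is recognizable if the words having it form a regular
language. Words are functions here, so that labellings of their positions, and graphs on their
positions, need no casts. -/
def Recognizable {α : Type*} (Φ : ∀ n, (Fin n → α) → Prop) : Prop :=
  Language.IsRegular ({x | Φ x.length x.get} : Language α)

/-- Transport of a property of words along the equality between a function on `Fin n` and the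
function read off its list of values, whose domain is only propositionally equal to `Fin n`. -/
theorem wordProperty_ofFn {α : Type*} (Φ : ∀ n, (Fin n → α) → Prop) {n : ℕ} (w : Fin n → α) :
    Φ (List.ofFn w).length (List.ofFn w).get ↔ Φ n w := by
  have : ∀ (m : ℕ) (v : Fin m → α) (h : m = n), (∀ i, v i = w (i.cast h)) → (Φ m v ↔ Φ n w) := by
    rintro m v rfl hv
    rw [show v = w from funext hv]
  exact this _ _ (by simp) fun i => by rw [List.get_ofFn]

namespace Recognizable

variable {α β : Type*} {Φ Ψ : ∀ n, (Fin n → α) → Prop}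

theorem of_iff (h : Recognizable Φ) (hi : ∀ n w, Ψ n w ↔ Φ n w) : Recognizable Ψ := by
  have : Ψ = Φ := by
    funext n w
    exact propext (hi n w)
  rwa [this]

theorem const (p : Prop) : Recognizable (fun n (_ : Fin n → α) => p) :=
  Language.isRegular_const p

theorem not (h : Recognizable Φ) : Recognizable (fun n w => ¬ Φ n w) :=
  Language.IsRegular.compl h

theorem and (h : Recognizable Φ) (h' : Recognizable Ψ) :
    Recognizable (fun n w => Φ n w ∧ Ψ n w) :=
  Language.IsRegular.inf h h'

theorem or (h : Recognizable Φ) (h' : Recognizable Ψ) :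
    Recognizable (fun n w => Φ n w ∨ Ψ n w) :=
  Language.IsRegular.add h h'

theorem imp (h : Recognizable Φ) (h' : Recognizable Ψ) :
    Recognizable (fun n w => Φ n w → Ψ n w) :=
  (h.not.or h').of_iff fun _ _ => imp_iff_not_or

theorem iff (h : Recognizable Φ) (h' : Recognizable Ψ) :
    Recognizable (fun n w => Φ n w ↔ Ψ n w) :=
  ((h.imp h').and (h'.imp h)).of_iff fun _ _ => iff_iff_implies_and_implies

theorem exists_finite {ι : Type*} [Finite ι] {Θ : ι → ∀ n, (Fin n → α) → Prop}
    (h : ∀ i, Recognizable (Θ i)) : Recognizable (fun n w => ∃ i, Θ i n w) :=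
  Language.isRegular_iUnion h

theorem forall_finite {ι : Type*} [Finite ι] {Θ : ι → ∀ n, (Fin n → α) → Prop}
    (h : ∀ i, Recognizable (Θ i)) : Recognizable (fun n w => ∀ i, Θ i n w) :=
  (exists_finite fun i => (h i).not).not.of_iff fun _ _ => by simp

/-- Quantification over the labellings of the positions of a word is projection of languages. -/
theorem exists_labelling {Θ : ∀ n, (Fin n → α) → (Fin n → β) → Prop}
    (h : Recognizable (fun n (w : Fin n → α × β) => Θ n (fun i => (w i).1) (fun i => (w i).2))) :
    Recognizable (fun n w => ∃ f, Θ n w f) := by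
  have := Language.IsRegular.map h Prod.fst
  refine this.of_mem_iff fun x => ?_
  constructor
  · rintro ⟨f, hf⟩
    exact ⟨List.ofFn fun i => (x.get i, f i),
      (wordProperty_ofFn (fun n (w : Fin n → α × β) => Θ n (fun i => (w i).1) (fun i => (w i).2))
        _).2 hf, by simp [List.map_ofFn, Function.comp_def]⟩
  · rintro ⟨y, hy, rfl⟩
    change ∃ f, Θ (y.map Prod.fst).length (y.map Prod.fst).get f
    rw [← List.ofFn_get y, List.map_ofFn]
    exact (wordProperty_ofFn (fun n w => ∃ f, Θ n w f) _).2 ⟨_, hy⟩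

theorem exists_letter (P : α → Prop) : Recognizable (fun n (w : Fin n → α) => ∃ i, P (w i)) := by
  have := ((Language.isRegular_const (α := α) True).mul (Language.isRegular_singleton P)).mul
    (Language.isRegular_const True)
  refine this.of_mem_iff fun x => ?_
  constructor
  · rintro ⟨i, hi⟩
    obtain ⟨s, t, h⟩ := List.append_of_mem (List.get_mem x i)
    exact ⟨_, ⟨s, trivial, _, ⟨_, hi, rfl⟩, rfl⟩, t, trivial, by simpa using h.symm⟩
  · rintro ⟨_, ⟨s, -, _, ⟨a, ha, rfl⟩, rfl⟩, t, -, rfl⟩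
    exact ⟨⟨s.length, by simp⟩, by simpa using ha⟩

theorem exists_first (P : α → Prop) :
    Recognizable (fun n (w : Fin n → α) => ∃ i : Fin n, i.val = 0 ∧ P (w i)) := by
  have := (Language.isRegular_singleton P).mul (Language.isRegular_const True)
  refine this.of_mem_iff fun x => ?_
  constructor
  · rintro ⟨⟨i, hi⟩, rfl : i = 0, h⟩
    cases x with
    | nil => simp at hi
    | cons a x => exact ⟨_, ⟨a, h, rfl⟩, x, trivial, rfl⟩
  · rintro ⟨_, ⟨a, ha, rfl⟩, t, -, rfl⟩
    exact ⟨⟨0, by simp⟩, rfl, ha⟩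

theorem exists_last (P : α → Prop) :
    Recognizable (fun n (w : Fin n → α) => ∃ i : Fin n, i.val + 1 = n ∧ P (w i)) := by
  have := (Language.isRegular_const True).mul (Language.isRegular_singleton P)
  refine this.of_mem_iff fun x => ?_
  constructor
  · rintro ⟨⟨i, hi⟩, h : i + 1 = _, hP⟩
    obtain rfl | ⟨y, a, rfl⟩ := List.eq_nil_or_concat x
    · simp at hi
    · have : i = y.length := by simpa using h
      subst this
      exact ⟨y, trivial, _, ⟨a, by simpa using hP, rfl⟩, by simp⟩
  · rintro ⟨t, -, _, ⟨a, ha, rfl⟩, rfl⟩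
    exact ⟨⟨t.length, by simp⟩, by simp, by simpa using ha⟩

theorem exists_consecutive [Finite α] (Q : α → α → Prop) :
    Recognizable (fun n (w : Fin n → α) =>
      ∃ i j : Fin n, i.val + 1 = j.val ∧ Q (w i) (w j)) := by
  have := Language.isRegular_iUnion fun a : α =>
    (((Language.isRegular_const (α := α) True).mul (Language.isRegular_singleton (· = a))).mul
      (Language.isRegular_singleton (Q a))).mul (Language.isRegular_const True)
  refine this.of_mem_iff fun x => ?_
  constructor
  · rintro ⟨⟨i, hi⟩, ⟨j, hj⟩, rfl : i + 1 = j, hQ⟩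
    refine ⟨x[i], _, ⟨_, ⟨x.take i, trivial, _, ⟨_, rfl, rfl⟩, rfl⟩, _, ⟨_, hQ, rfl⟩, rfl⟩,
      x.drop (i + 2), trivial, ?_⟩
    simp
  · rintro ⟨a, _, ⟨_, ⟨s, -, _, ⟨_, rfl, rfl⟩, rfl⟩, _, ⟨b, hb, rfl⟩, rfl⟩, t, -, rfl⟩
    refine ⟨⟨s.length, by simp⟩, ⟨s.length + 1, by simp⟩, rfl, ?_⟩
    simpa using hb

end Recognizable

/-! ### Induced paths as minimal connectors -/

theorem Fin.exists_fin_add_two {m : ℕ} {p : Fin (m + 1 + 1) → Prop} :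
    (∃ i, p i) ↔ (∃ k : Fin m, p k.castSucc.succ) ∨ p 0 ∨ p (Fin.last (m + 1)) := by
  rw [Fin.exists_fin_succ, Fin.exists_fin_succ', Fin.succ_last]
  tauto

theorem Fin.forall_fin_add_two {m : ℕ} {P : Fin (m + 1 + 1) → Prop} :
    (∀ i, P i) ↔ P 0 ∧ P (Fin.last (m + 1)) ∧ ∀ k : Fin m, P k.castSucc.succ := by
  rw [Fin.forall_fin_succ, Fin.forall_fin_succ', Fin.succ_last]
  tauto

namespace SimpleGraph

variable {W : Type*} (G : SimpleGraph W)

/-- The set `Z` of vertices induces a connected or empty subgraph: whenever a set `C` separates two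
elements of `Z`, some edge within `Z` leaves `C`. This form speaks only of sets of vertices and of
edges, with a single quantifier over sets. -/
def NoCut (Z : W → Prop) : Prop :=
  ∀ C : W → Prop, (∃ x, Z x ∧ C x) → (∃ y, Z y ∧ ¬ C y) →
    ∃ x y, G.Adj x y ∧ (Z x ∧ C x) ∧ (Z y ∧ ¬ C y)

/-- The set `X` is minimal among the sets whose union with `E` is connected. -/
def MinimalConnector (X E : W → Prop) : Prop :=
  G.NoCut (fun x => X x ∨ E x) ∧
    ¬ ∃ Y : W → Prop, (∃ x, X x ∧ ¬ Y x) ∧ G.NoCut (fun x => (X x ∧ Y x) ∨ E x)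

variable {G}

theorem noCut_range {L : ℕ} {g : Fin (L + 1) → W}
    (hg : ∀ i : Fin L, G.Adj (g i.castSucc) (g i.succ)) :
    G.NoCut (fun x => ∃ i, g i = x) := by
  rintro C ⟨_, ⟨i, rfl⟩, hi⟩ ⟨_, ⟨j, rfl⟩, hj⟩
  by_contra! h
  -- Without an edge leaving `C`, membership in `C` is constant along the sequence.
  have step : ∀ i : Fin L, C (g i.castSucc) ↔ C (g i.succ) := fun i =>
    ⟨fun hc => by_contra fun hn => hn (h _ _ (hg i) ⟨⟨_, rfl⟩, hc⟩ ⟨_, rfl⟩),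
      fun hc => by_contra fun hn => hn (h _ _ (hg i).symm ⟨⟨_, rfl⟩, hc⟩ ⟨_, rfl⟩)⟩
  have const : ∀ i, C (g i) ↔ C (g 0) := fun i => by
    induction i using Fin.induction with
    | zero => rfl
    | succ i ih => rw [← step, ih]
  exact hj ((const j).2 ((const i).1 hi))

theorem minimalConnector_of_path {m : ℕ} {g : Fin (m + 1 + 1) → W} (hinj : Function.Injective g)
    (hg : ∀ i j, G.Adj (g i) (g j) ↔ (pathGraph (m + 1 + 1)).Adj i j) {X E : W → Prop}
    (hX : ∀ x, X x ↔ ∃ k : Fin m, g k.castSucc.succ = x)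
    (hE : ∀ x, E x ↔ g 0 = x ∨ g (Fin.last (m + 1)) = x) :
    G.MinimalConnector X E := by
  have hXE : ∀ x, X x ∨ E x ↔ ∃ i, g i = x := fun x => by
    rw [Fin.exists_fin_add_two, hX, hE]
  constructor
  · simp_rw [hXE]
    exact noCut_range fun i => by simp [hg, pathGraph_adj]
  · rintro ⟨Y, ⟨x, hx, hxY⟩, hY⟩
    obtain ⟨k, rfl⟩ := (hX x).1 hx
    -- The initial segment of the path that ends just before the missing vertex is a cut.
    obtain ⟨_, y, hadj, ⟨-, i, hi, rfl⟩, hy, hyC⟩ := hY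
      (fun x => ∃ i, i < k.castSucc.succ ∧ g i = x)
      ⟨g 0, Or.inr ((hE _).2 (Or.inl rfl)), 0, Fin.succ_pos _, rfl⟩
      ⟨g (Fin.last (m + 1)), Or.inr ((hE _).2 (Or.inr rfl)), by
        rintro ⟨i, hi, h⟩
        exact absurd (hinj h ▸ hi) (Fin.le_last _).not_gt⟩
    obtain ⟨j, rfl⟩ := (hXE y).1 (hy.imp And.left id)
    have hkj : k.castSucc.succ ≤ j := not_lt.1 fun h => hyC ⟨j, h, rfl⟩
    have hij : j = k.castSucc.succ := by
      rw [hg, pathGraph_adj] at hadj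
      rw [Fin.ext_iff]
      rw [Fin.lt_def] at hi
      rw [Fin.le_def] at hkj
      omega
    subst hij
    rcases hy with hy | hy
    · exact hxY hy.2
    · rcases (hE _).1 hy with h | h
      · exact absurd (hinj h) (Fin.succ_ne_zero _).symm
      · have := congrArg Fin.val (hinj h)
        simp at this
        omega

/-- A shortest walk is an induced path. -/
theorem Walk.adj_getVert_iff_of_length_eq_dist {u v : W} {p : G.Walk u v}
    (hp : p.length = G.dist u v) {i j : ℕ} (hi : i ≤ p.length) (hj : j ≤ p.length) :
    G.Adj (p.getVert i) (p.getVert j) ↔ i + 1 = j ∨ j + 1 = i := by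
  have key : ∀ i j, i ≤ j → j ≤ p.length → G.Adj (p.getVert i) (p.getVert j) → i + 1 = j := by
    intro i j hij hj h
    have h₁ := dist_le ((p.take i).append (Walk.cons h (p.drop j)))
    rw [Walk.length_append, Walk.length_cons, Walk.take_length, Walk.drop_length] at h₁
    have : i ≠ j := fun e => h.ne (by rw [e])
    omega
  constructor
  · intro h
    rcases le_total i j with hij | hij
    · exact Or.inl (key i j hij hj h)
    · exact Or.inr (key j i hij hi h.symm)
  · rintro (rfl | rfl)
    · exact p.adj_getVert_succ (by omega)
    · exact (p.adj_getVert_succ (by omega)).symm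

/-- A minimal connector of two nonadjacent vertices consists of the internal vertices of an induced
path: a shortest path already connects the two, so minimality leaves no further vertices. -/
theorem MinimalConnector.exists_path {X E : W → Prop} (h : G.MinimalConnector X E) {a b : W}
    (hab : a ≠ b) (hnadj : ¬ G.Adj a b) (hE : ∀ x, E x ↔ a = x ∨ b = x) :
    ∃ (m : ℕ) (g : Fin (m + 1 + 1) → W), 1 ≤ m ∧ Function.Injective g ∧
      (∀ i j, G.Adj (g i) (g j) ↔ (pathGraph (m + 1 + 1)).Adj i j) ∧
      g 0 = a ∧ g (Fin.last (m + 1)) = b ∧ ∀ x, X x ↔ ∃ k : Fin m, g k.castSucc.succ = x := by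
  obtain ⟨hconn, hmin⟩ := h
  have ha : X a ∨ E a := Or.inr ((hE a).2 (Or.inl rfl))
  have hb : X b ∨ E b := Or.inr ((hE b).2 (Or.inr rfl))
  let G' := G.induce {x | X x ∨ E x}
  have hreach : G'.Reachable ⟨a, ha⟩ ⟨b, hb⟩ := by
    by_contra hn
    obtain ⟨x, y, hadj, ⟨-, hx, hr⟩, hy, hyC⟩ :=
      hconn (fun x => ∃ hx : X x ∨ E x, G'.Reachable ⟨a, ha⟩ ⟨x, hx⟩)
        ⟨a, ha, ha, Reachable.refl _⟩ ⟨b, hb, fun ⟨_, h⟩ => hn h⟩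
    exact hyC ⟨hy, hr.trans (Adj.reachable (G := G') (u := ⟨x, hx⟩) (v := ⟨y, hy⟩) hadj)⟩
  obtain ⟨p, hp⟩ := hreach.exists_walk_length_eq_dist
  have hadj : ∀ {i j : ℕ}, i ≤ p.length → j ≤ p.length →
      (G.Adj (p.getVert i) (p.getVert j) ↔ i + 1 = j ∨ j + 1 = i) := fun hi hj =>
    Walk.adj_getVert_iff_of_length_eq_dist hp hi hj
  have hinj := (p.isPath_of_length_eq_dist hp).getVert_injOn
  have h0 : (p.getVert 0 : W) = a := by rw [Walk.getVert_zero]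
  have hl : (p.getVert p.length : W) = b := by rw [Walk.getVert_length]
  obtain ⟨m, hm⟩ : ∃ m, p.length = m + 1 := by
    refine Nat.exists_eq_succ_of_ne_zero fun h => hab ?_
    exact h0.symm.trans ((congrArg (fun i => (p.getVert i : W)) h.symm).trans hl)
  have hm1 : 1 ≤ m := by
    by_contra hm0
    have h := (hadj (Nat.zero_le _) le_rfl).2 (Or.inl (by omega : 0 + 1 = p.length))
    rw [h0, hl] at h
    exact hnadj h
  let g : Fin (m + 1 + 1) → W := fun i => p.getVert i
  have hg0 : g 0 = a := h0
  have hgl : g (Fin.last (m + 1)) = b := by rw [← hl, hm]; rfl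
  have hgadj : ∀ i j, G.Adj (g i) (g j) ↔ (pathGraph (m + 1 + 1)).Adj i j := fun i j => by
    rw [pathGraph_adj]
    exact hadj (by omega) (by omega)
  have hginj : Function.Injective g := fun i j hij =>
    Fin.ext (hinj (by simp; omega) (by simp; omega) (Subtype.ext hij))
  have hE' : ∀ x, E x ↔ g 0 = x ∨ g (Fin.last (m + 1)) = x := by rwa [hg0, hgl]
  have hgX : ∀ k : Fin m, X (g k.castSucc.succ) := fun k => by
    refine (p.getVert (k.castSucc.succ : Fin (m + 1 + 1))).2.resolve_right fun hk => ?_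
    rcases (hE' _).1 hk with h | h
    · exact absurd (hginj h) (Fin.succ_ne_zero _).symm
    · have := congrArg Fin.val (hginj h)
      simp at this
      omega
  refine ⟨m, g, hm1, hginj, hgadj, hg0, hgl, fun x => ⟨fun hx => ?_, ?_⟩⟩
  · by_contra hn
    -- The vertices of the path other than `x` would form a smaller connector.
    refine hmin ⟨fun x => ∃ k : Fin m, g k.castSucc.succ = x, ⟨x, hx, hn⟩, ?_⟩
    convert noCut_range (G := G) (g := g) fun i => by simp [hgadj, pathGraph_adj] using 2 with y
    rw [Fin.exists_fin_add_two, hE', and_iff_right_of_imp]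
    rintro ⟨k, rfl⟩
    exact hgX k
  · rintro ⟨k, rfl⟩
    exact hgX k

end SimpleGraph

/-! ### Containment of a pathograph as existence of a labelling -/

namespace Pathograph

/-- A labelling of the vertices of a graph `G` by the vertices and the urpaths of `F` that describes
an induced subgraph of `G` which is a realization of `F`. The vertices without a label are those
outside of the subgraph, and the label of an internal vertex of a path is the urpath it belongs to;
the order of the vertices on a path is not recorded. -/
structure IsModel (F : Pathograph.{w}) {W : Type*} (G : SimpleGraph W)
    (ℓ : W → Option (F.V ⊕ F.U)) : Prop where
  exists_vertex : ∀ v, ∃ x, ℓ x = some (.inl v)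
  vertex_unique : ∀ v x y, ℓ x = some (.inl v) → ℓ y = some (.inl v) → x = y
  edge : ∀ v v', F.edge.Adj v v' ↔
    ∃ x y, G.Adj x y ∧ ℓ x = some (.inl v) ∧ ℓ y = some (.inl v')
  spoke : ∀ v p, F.spoke v p → ∃ x y, G.Adj x y ∧ ℓ x = some (.inl v) ∧ ℓ y = some (.inr p)
  not_spoke : ∀ v p, ¬ F.spoke v p → v ∉ F.ends p →
    ¬ ∃ x y, G.Adj x y ∧ ℓ x = some (.inl v) ∧ ℓ y = some (.inr p)
  rung : ∀ p q, p ≠ q → (F.rung.Adj p q ↔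
    ∃ x y, G.Adj x y ∧ ℓ x = some (.inr p) ∧ ℓ y = some (.inr q))
  path : ∀ p, G.MinimalConnector (fun x => ℓ x = some (.inr p))
    (fun x => ∃ v, v ∈ F.ends p ∧ ℓ x = some (.inl v))

section

variable {F : Pathograph.{w}} (o : F.Orientation)

theorem Orientation.mem_ends {p : F.U} {v : F.V} : v ∈ F.ends p ↔ v = o.left p ∨ v = o.right p := by
  rw [o.ends_eq, Sym2.mem_iff]

theorem Orientation.left_ne_right (p : F.U) : o.left p ≠ o.right p := by
  simpa [o.ends_eq] using F.ends_ne p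

theorem Orientation.not_adj (p : F.U) : ¬ F.edge.Adj (o.left p) (o.right p) := by
  simpa [o.ends_eq] using F.ends_nonadj p

theorem nonempty_orientation (F : Pathograph.{w}) : Nonempty F.Orientation :=
  ⟨⟨fun p => (F.ends p).out.1, fun p => (F.ends p).out.2, fun _ => (Quot.out_eq _).symm⟩⟩

@[simp]
theorem pathSeq_zero (len : F.U → ℕ) (p : F.U) : pathSeq o len p 0 = .inl (o.left p) := rfl

@[simp]
theorem pathSeq_last (len : F.U → ℕ) (p : F.U) :
    pathSeq o len p (Fin.last (len p + 1)) = .inl (o.right p) := by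
  rw [pathSeq, ← Fin.succ_last, Fin.cons_succ, Fin.snoc_last]

@[simp]
theorem pathSeq_castSucc_succ (len : F.U → ℕ) (p : F.U) (k : Fin (len p)) :
    pathSeq o len p k.castSucc.succ = .inr ⟨p, k⟩ := by
  rw [pathSeq, Fin.cons_succ, Fin.snoc_castSucc]

theorem pathSeq_injective (len : F.U → ℕ) (p : F.U) : Function.Injective (pathSeq o len p) := by
  have h := o.left_ne_right p
  unfold Function.Injective
  simp only [Fin.forall_fin_add_two, pathSeq_zero, pathSeq_last, pathSeq_castSucc_succ]
  simp [h, h.symm]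

end

variable {F : Pathograph.{w}} {W : Type u} {G : SimpleGraph W}

theorem ContainedIn.exists_isModel (h : F.ContainedIn G) : ∃ ℓ, F.IsModel G ℓ := by
  obtain ⟨o, R, ⟨φ⟩⟩ := h
  let lab : F.RealizationVertex R.len → F.V ⊕ F.U := Sum.map id Sigma.fst
  let ℓ : W → Option (F.V ⊕ F.U) := Function.extend φ (fun z => some (lab z)) fun _ => none
  have hℓ : ∀ x c, ℓ x = some c ↔ ∃ z, φ z = x ∧ lab z = c := by
    intro x c
    by_cases hx : ∃ z, φ z = x
    · obtain ⟨z, rfl⟩ := hx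
      simp [ℓ, φ.injective.extend_apply]
    · have : ℓ x = none := Function.extend_apply' _ _ _ hx
      rw [this]
      simp only [reduceCtorEq, false_iff]
      rintro ⟨z, rfl, -⟩
      exact hx ⟨z, rfl⟩
  have hv : ∀ x v, ℓ x = some (.inl v) ↔ φ (.inl v) = x := by
    intro x v
    rw [hℓ]
    constructor
    · rintro ⟨z | z, rfl, h⟩
      · cases h
        rfl
      · cases h
    · rintro rfl
      exact ⟨_, rfl, rfl⟩
  have hp : ∀ x p, ℓ x = some (.inr p) ↔ ∃ k, φ (.inr ⟨p, k⟩) = x := by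
    intro x p
    rw [hℓ]
    constructor
    · rintro ⟨z | ⟨q, k⟩, rfl, h⟩
      · cases h
      · cases h
        exact ⟨k, rfl⟩
    · rintro ⟨k, rfl⟩
      exact ⟨_, rfl, rfl⟩
  refine ⟨ℓ, ?_, ?_, ?_, ?_, ?_, ?_, ?_⟩
  · exact fun v => ⟨_, (hv _ v).2 rfl⟩
  · intro v x y hx hy
    rw [hv] at hx hy
    exact hx.symm.trans hy
  · intro v v'
    simp_rw [hv]
    simp [R.adj_vertex]
  · intro v p h
    obtain ⟨k, hk⟩ := R.adj_of_spoke v p h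
    exact ⟨_, _, φ.map_adj_iff.2 hk, (hv _ _).2 rfl, (hp _ _).2 ⟨k, rfl⟩⟩
  · rintro v p h h' ⟨x, y, hxy, hx, hy⟩
    obtain rfl := (hv _ _).1 hx
    obtain ⟨k, rfl⟩ := (hp _ _).1 hy
    exact R.not_adj_of_not_spoke v p h h' k (φ.map_adj_iff.1 hxy)
  · intro p q hpq
    constructor
    · intro h
      obtain ⟨k, l, hkl⟩ := R.adj_of_rung p q h
      exact ⟨_, _, φ.map_adj_iff.2 hkl, (hp _ _).2 ⟨k, rfl⟩, (hp _ _).2 ⟨l, rfl⟩⟩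
    · rintro ⟨x, y, hxy, hx, hy⟩
      obtain ⟨k, rfl⟩ := (hp _ _).1 hx
      obtain ⟨l, rfl⟩ := (hp _ _).1 hy
      by_contra h
      exact R.not_adj_of_not_rung p q hpq h k l (φ.map_adj_iff.1 hxy)
  · intro p
    refine SimpleGraph.minimalConnector_of_path (g := φ ∘ pathSeq o R.len p)
      (φ.injective.comp (pathSeq_injective o R.len p))
      (fun i j => φ.map_adj_iff.trans (R.induced_path p i j)) ?_ ?_
    · simp [hp]
    · simp [hv, o.mem_ends]

theorem IsModel.containedIn {ℓ : W → Option (F.V ⊕ F.U)} (h : F.IsModel G ℓ) :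
    F.ContainedIn G := by
  -- Labellings do not refer to an orientation, so any one will do.
  obtain ⟨o⟩ := F.nonempty_orientation
  choose ξ hξ using h.exists_vertex
  have hξ' : ∀ x v, ℓ x = some (.inl v) ↔ ξ v = x := fun x v =>
    ⟨fun hx => h.vertex_unique v _ _ (hξ v) hx, fun hx => hx ▸ hξ v⟩
  have hadj : ∀ v v', G.Adj (ξ v) (ξ v') ↔ F.edge.Adj v v' := fun v v' => by
    rw [h.edge]
    simp [hξ']
  have hpath := fun p => (h.path p).exists_path (a := ξ (o.left p)) (b := ξ (o.right p))
    (fun he => o.left_ne_right p (by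
      have := hξ (o.left p)
      rw [he, hξ] at this
      simpa using this.symm))
    (fun ha => o.not_adj p ((hadj _ _).1 ha))
    (fun x => by simp [hξ', o.mem_ends])
  choose len g hlen hinj hg hg0 hgl hX using hpath
  let φ : F.RealizationVertex len → W := Sum.elim ξ fun z => g z.1 z.2.castSucc.succ
  have hφ : ∀ z, ℓ (φ z) = some (Sum.map id Sigma.fst z) := by
    rintro (v | ⟨p, k⟩)
    · exact hξ v
    · exact (hX p _).2 ⟨k, rfl⟩
  have hφinj : Function.Injective φ := by
    rintro z z' hz
    have hl := hφ z
    rw [hz, hφ] at hl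
    rcases z with v | ⟨p, k⟩ <;> rcases z' with v' | ⟨p', k'⟩ <;> simp at hl
    · rw [hl]
    · subst hl
      simpa [Fin.ext_iff] using hinj _ hz
  have hseq : ∀ p i, φ (pathSeq o len p i) = g p i := by
    intro p
    rw [Fin.forall_fin_add_two]
    simp [φ, hg0, hgl]
  refine ⟨o, ⟨len, hlen, G.comap φ, hadj, ?_, ?_, ?_, ?_, ?_⟩, ⟨⟨⟨φ, hφinj⟩, Iff.rfl⟩⟩⟩
  · intro p i j
    rw [SimpleGraph.comap_adj, hseq, hseq, hg]
  · intro v p hs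
    obtain ⟨x, y, hxy, hx, hy⟩ := h.spoke v p hs
    obtain rfl := (hξ' _ _).1 hx
    obtain ⟨k, rfl⟩ := (hX _ _).1 hy
    exact ⟨k, hxy⟩
  · intro v p hs hv k hk
    exact h.not_spoke v p hs hv ⟨_, _, hk, hφ (.inl v), hφ (.inr ⟨p, k⟩)⟩
  · intro p q hpq
    obtain ⟨x, y, hxy, hx, hy⟩ := (h.rung p q hpq.ne).1 hpq
    obtain ⟨k, rfl⟩ := (hX _ _).1 hx
    obtain ⟨l, rfl⟩ := (hX _ _).1 hy
    exact ⟨k, l, hxy⟩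
  · intro p q hpq hr k l hkl
    exact hr ((h.rung p q hpq).2 ⟨_, _, hkl, hφ (.inr ⟨p, k⟩), hφ (.inr ⟨q, l⟩)⟩)

theorem containedIn_iff_exists_isModel : F.ContainedIn G ↔ ∃ ℓ, F.IsModel G ℓ :=
  ⟨ContainedIn.exists_isModel, fun ⟨_, h⟩ => h.containedIn⟩

end Pathograph

/-! ### Recognizability for graphs encoded by words -/

/-- The graph that a word `w` over `ι × Set V` encodes. Its vertices are those of `E` and the
positions of `w`. The second component of a letter is the neighbourhood of its position in `V`;
consecutive positions are adjacent if their first components agree. -/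
def wordGraph {V ι : Type*} (E : SimpleGraph V) {n : ℕ} (w : Fin n → ι × Set V) :
    SimpleGraph (V ⊕ Fin n) where
  Adj
    | .inl v, .inl v' => E.Adj v v'
    | .inl v, .inr j => v ∈ (w j).2
    | .inr j, .inl v => v ∈ (w j).2
    | .inr i, .inr j => (i.val + 1 = j.val ∨ j.val + 1 = i.val) ∧ (w i).1 = (w j).1
  symm := ⟨by
    rintro (v | i) (v' | j) h
    · exact SimpleGraph.Adj.symm h
    · exact h
    · exact h
    · exact ⟨h.1.symm, h.2.symm⟩⟩
  loopless := ⟨by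
    rintro (v | i) h
    · exact E.irrefl h
    · obtain ⟨h | h, -⟩ := h <;> omega⟩

namespace Recognizable

variable {V ι α β γ : Type*}

/-- The vertices of the encoded graph are labelled by `h` on `V`, and by `g` of the letter on the
positions; thus a word over `α` carries a labelling along with the graph. -/
theorem exists_vertex (h : V → β) (g : α → β) (P : β → Prop) :
    Recognizable fun n (w : Fin n → α) => ∃ x : V ⊕ Fin n, P (Sum.elim h (fun i => g (w i)) x) :=
  ((const (∃ v, P (h v))).or (exists_letter fun a => P (g a))).of_iff fun n w => by
    simp only [Sum.exists, Sum.elim_inl, Sum.elim_inr]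

/-- The map `a` forgets the labels, leaving the letters that encode the graph. The four kinds of
adjacent pairs are distinguished. -/
theorem exists_adj [Finite V] [Finite α]
    (E : SimpleGraph V) (a : α → ι × Set V) (h : V → β) (g : α → β) (P : β → β → Prop) :
    Recognizable fun n (w : Fin n → α) => ∃ x y : V ⊕ Fin n,
      (wordGraph E fun i => a (w i)).Adj x y ∧ P (Sum.elim h (fun i => g (w i)) x)
        (Sum.elim h (fun i => g (w i)) y) := by
  have h₁ : Recognizable fun n (_ : Fin n → α) => ∃ v v', E.Adj v v' ∧ P (h v) (h v') := const _
  have h₂ : Recognizable fun n (w : Fin n → α) => ∃ v, ∃ j, v ∈ (a (w j)).2 ∧ P (h v) (g (w j)) :=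
    exists_finite fun v => exists_letter fun c => v ∈ (a c).2 ∧ P (h v) (g c)
  have h₃ : Recognizable fun n (w : Fin n → α) => ∃ v, ∃ j, v ∈ (a (w j)).2 ∧ P (g (w j)) (h v) :=
    exists_finite fun v => exists_letter fun c => v ∈ (a c).2 ∧ P (g c) (h v)
  have h₄ := exists_consecutive fun c d => (a c).1 = (a d).1 ∧ (P (g c) (g d) ∨ P (g d) (g c))
  refine (((h₁.or h₂).or h₃).or h₄).of_iff fun n w => ?_
  constructor
  · rintro ⟨v | i, v' | j, hadj, hP⟩
    · exact .inl (.inl (.inl ⟨v, v', hadj, hP⟩))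
    · exact .inl (.inl (.inr ⟨v, j, hadj, hP⟩))
    · exact .inl (.inr ⟨v', i, hadj, hP⟩)
    · obtain ⟨hij | hij, he⟩ := hadj
      · exact .inr ⟨i, j, hij, he, .inl hP⟩
      · exact .inr ⟨j, i, hij, he.symm, .inr hP⟩
  · rintro (((⟨v, v', hadj, hP⟩ | ⟨v, j, hadj, hP⟩) | ⟨v, j, hadj, hP⟩) |
      ⟨i, j, hij, he, hP | hP⟩)
    · exact ⟨.inl v, .inl v', hadj, hP⟩
    · exact ⟨.inl v, .inr j, hadj, hP⟩
    · exact ⟨.inr j, .inl v, hadj, hP⟩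
    · exact ⟨.inr i, .inr j, ⟨.inl hij, he⟩, hP⟩
    · exact ⟨.inr j, .inr i, ⟨.inr hij, he.symm⟩, hP⟩

/-- Quantification over the labellings of the vertices of the encoded graph: the labels of the
vertices in `V` are one of finitely many choices, those of the positions are projected away. -/
theorem exists_vertex_labelling [Finite V] [Finite γ]
    {Θ : ∀ n, (Fin n → α) → (V ⊕ Fin n → γ) → Prop}
    (h : ∀ c : V → γ, Recognizable fun n (w : Fin n → α × γ) =>
      Θ n (fun i => (w i).1) (Sum.elim c fun i => (w i).2)) :
    Recognizable fun n w => ∃ ℓ, Θ n w ℓ := by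
  refine (exists_finite fun c => exists_labelling
    (Θ := fun n w f => Θ n w (Sum.elim c f)) (h c)).of_iff fun n w => ?_
  constructor
  · rintro ⟨ℓ, hℓ⟩
    exact ⟨ℓ ∘ Sum.inl, ℓ ∘ Sum.inr, by rwa [Sum.elim_comp_inl_inr]⟩
  · rintro ⟨c, f, h⟩
    exact ⟨_, h⟩

theorem pair_sumElim {σ τ : Type*} (h : σ → β) (c : σ → γ) (f : τ → β) (d : τ → γ) (x : σ ⊕ τ) :
    Sum.elim (fun v => (h v, c v)) (fun i => (f i, d i)) x = (Sum.elim h f x, Sum.elim c d x) := by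
  cases x <;> rfl

/-- Connectedness of the set of vertices whose label lies in `Z` is recognizable: the separating set
is quantified as an additional labelling by propositions. -/
theorem noCut [Finite V] [Finite α]
    (E : SimpleGraph V) (a : α → ι × Set V) (h : V → β) (g : α → β) (Z : β → Prop) :
    Recognizable fun n (w : Fin n → α) => (wordGraph E fun i => a (w i)).NoCut
      fun x => Z (Sum.elim h (fun i => g (w i)) x) := by
  unfold SimpleGraph.NoCut
  refine (exists_vertex_labelling (Θ := fun n (w : Fin n → α) (C : V ⊕ Fin n → Prop) =>
    ¬ ((∃ x, Z (Sum.elim h (fun i => g (w i)) x) ∧ C x) →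
      (∃ x, Z (Sum.elim h (fun i => g (w i)) x) ∧ ¬ C x) →
      ∃ x y, (wordGraph E fun i => a (w i)).Adj x y ∧
        (Z (Sum.elim h (fun i => g (w i)) x) ∧ C x) ∧
        (Z (Sum.elim h (fun i => g (w i)) y) ∧ ¬ C y))) fun c => ?_).not.of_iff fun n w =>
          not_exists_not.symm
  have h₁ := exists_vertex (α := α × Prop) (fun v => (h v, c v)) (fun q => (g q.1, q.2))
    (fun t => Z t.1 ∧ t.2)
  have h₂ := exists_vertex (α := α × Prop) (fun v => (h v, c v)) (fun q => (g q.1, q.2))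
    (fun t => Z t.1 ∧ ¬ t.2)
  have h₃ := exists_adj E (fun q : α × Prop => a q.1) (fun v => (h v, c v)) (fun q => (g q.1, q.2))
    (fun t t' => (Z t.1 ∧ t.2) ∧ (Z t'.1 ∧ ¬ t'.2))
  refine (h₁.imp (h₂.imp h₃)).not.of_iff fun n w => ?_
  simp only [pair_sumElim]

theorem minimalConnector [Finite V] [Finite α]
    (E : SimpleGraph V) (a : α → ι × Set V) (h : V → β) (g : α → β) (X D : β → Prop) :
    Recognizable fun n (w : Fin n → α) => (wordGraph E fun i => a (w i)).MinimalConnector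
      (fun x => X (Sum.elim h (fun i => g (w i)) x))
      (fun x => D (Sum.elim h (fun i => g (w i)) x)) := by
  refine (noCut E a h g fun t => X t ∨ D t).and (exists_vertex_labelling (Θ := fun n w Y =>
    (∃ x, X (Sum.elim h (fun i => g (w i)) x) ∧ ¬ Y x) ∧
      (wordGraph E fun i => a (w i)).NoCut fun x =>
        (X (Sum.elim h (fun i => g (w i)) x) ∧ Y x) ∨ D (Sum.elim h (fun i => g (w i)) x))
    fun c => ?_).not
  have h₁ := exists_vertex (α := α × Prop) (fun v => (h v, c v)) (fun q => (g q.1, q.2))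
    (fun t => X t.1 ∧ ¬ t.2)
  have h₂ := noCut E (fun q : α × Prop => a q.1) (fun v => (h v, c v)) (fun q => (g q.1, q.2))
    (fun t => (X t.1 ∧ t.2) ∨ D t.1)
  refine (h₁.and h₂).of_iff fun n w => ?_
  simp only [pair_sumElim]

/-- At most one vertex has a label in `P`: no set of vertices separates two such vertices. -/
theorem vertex_unique [Finite V] (h : V → β) (g : α → β) (P : β → Prop) :
    Recognizable fun n (w : Fin n → α) => ∀ x y : V ⊕ Fin n,
      P (Sum.elim h (fun i => g (w i)) x) → P (Sum.elim h (fun i => g (w i)) y) → x = y := by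
  refine (exists_vertex_labelling (Θ := fun n (w : Fin n → α) (C : V ⊕ Fin n → Prop) =>
    (∃ x, P (Sum.elim h (fun i => g (w i)) x) ∧ C x) ∧
      ∃ x, P (Sum.elim h (fun i => g (w i)) x) ∧ ¬ C x) fun c => ?_).not.of_iff fun n w => ?_
  · have h₁ := exists_vertex (α := α × Prop) (fun v => (h v, c v)) (fun q => (g q.1, q.2))
      (fun t => P t.1 ∧ t.2)
    have h₂ := exists_vertex (α := α × Prop) (fun v => (h v, c v)) (fun q => (g q.1, q.2))
      (fun t => P t.1 ∧ ¬ t.2)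
    refine (h₁.and h₂).of_iff fun n w => ?_
    simp only [pair_sumElim]
  · constructor
    · rintro hu ⟨C, ⟨x, hx, hC⟩, y, hy, hC'⟩
      exact hC' (hu x y hx hy ▸ hC)
    · intro hn x y hx hy
      by_contra hxy
      exact hn ⟨(· = x), ⟨x, hx, rfl⟩, y, hy, fun h => hxy h.symm⟩

/-- Each clause in the definition of a model is a Boolean combination, over finitely many vertices
and urpaths of `F`, of recognizable properties. -/
theorem isModel [Finite V] [Finite α] (E : SimpleGraph V) (a : α → ι × Set V) (F : Pathograph.{w})
    (h : V → Option (F.V ⊕ F.U)) (g : α → Option (F.V ⊕ F.U)) :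
    Recognizable fun n (w : Fin n → α) =>
      F.IsModel (wordGraph E fun i => a (w i)) (Sum.elim h fun i => g (w i)) := by
  have := F.finite_V
  have := F.finite_U
  have adj := fun c c' => exists_adj E a h g fun t t' => t = some c ∧ t' = some c'
  have h₁ := forall_finite fun v : F.V => exists_vertex h g (· = some (.inl v))
  have h₂ := forall_finite fun v : F.V => vertex_unique h g (· = some (.inl v))
  have h₃ := forall_finite fun v : F.V => forall_finite fun v' : F.V =>
    (const (F.edge.Adj v v')).iff (adj (.inl v) (.inl v'))
  have h₄ := forall_finite fun v : F.V => forall_finite fun p : F.U =>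
    (const (F.spoke v p)).imp (adj (.inl v) (.inr p))
  have h₅ := forall_finite fun v : F.V => forall_finite fun p : F.U =>
    (const (¬ F.spoke v p)).imp ((const (v ∉ F.ends p)).imp (adj (.inl v) (.inr p)).not)
  have h₆ := forall_finite fun p : F.U => forall_finite fun q : F.U =>
    (const (p ≠ q)).imp ((const (F.rung.Adj p q)).iff (adj (.inr p) (.inr q)))
  have h₇ := forall_finite fun p : F.U => minimalConnector E a h g (· = some (.inr p))
    fun t => ∃ v, v ∈ F.ends p ∧ t = some (.inl v)
  refine (h₁.and (h₂.and (h₃.and (h₄.and (h₅.and (h₆.and h₇)))))).of_iff fun n w => ?_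
  exact ⟨fun ⟨h₁, h₂, h₃, h₄, h₅, h₆, h₇⟩ => ⟨h₁, h₂, h₃, h₄, h₅, h₆, h₇⟩,
    fun ⟨h₁, h₂, h₃, h₄, h₅, h₆, h₇⟩ => ⟨h₁, h₂, h₃, h₄, h₅, h₆, h₇⟩⟩

theorem containedIn {V : Type u} {ι : Type*} [Finite V] [Finite ι] (E : SimpleGraph V)
    (F : Pathograph.{w}) :
    Recognizable fun n (w : Fin n → ι × Set V) => F.ContainedIn (wordGraph E w) := by
  have := F.finite_V
  have := F.finite_U
  refine (exists_vertex_labelling (Θ := fun n (w : Fin n → ι × Set V) ℓ =>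
    F.IsModel (wordGraph E w) ℓ) fun c => ?_).of_iff fun n w =>
      Pathograph.containedIn_iff_exists_isModel
  exact isModel E (fun q : (ι × Set V) × Option (F.V ⊕ F.U) => q.1) F c fun q => q.2

theorem isFree {V : Type u} {ι : Type*} [Finite V] [Finite ι] (E : SimpleGraph V)
    {𝓕 : Set Pathograph.{w}} (h𝓕 : 𝓕.Finite) :
    Recognizable fun n (w : Fin n → ι × Set V) => Pathograph.IsFree 𝓕 (wordGraph E w) := by
  have := h𝓕.to_subtype
  exact (forall_finite fun F : 𝓕 => (containedIn E F.1).not).of_iff fun n w =>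
    Subtype.forall'

end Recognizable

/-! ### Determination strings -/

/-- The `k`-th entry of the `i`-th list stands in the concatenation at position `k` plus the total
length of the earlier lists. -/
theorem List.getElem_flatten_offset {α : Type*} (L : List (List α)) (i : ℕ) (hi : i < L.length)
    (k : ℕ) (hk : k < L[i].length) :
    ∃ h : ((L.take i).map List.length).sum + k < L.flatten.length,
      L.flatten[((L.take i).map List.length).sum + k] = L[i][k] := by
  have hL : L.flatten = (L.take i).flatten ++ (L[i] ++ (L.drop (i + 1)).flatten) := by
    rw [← List.flatten_cons, ← List.flatten_append]
    simp
  rw [← List.length_flatten]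
  have h : (L.take i).flatten.length + k < L.flatten.length := by
    rw [hL, List.length_append, List.length_append]
    omega
  refine ⟨h, ?_⟩
  have h' := List.getElem_of_eq hL h
  rw [h', List.getElem_append_right (by omega), List.getElem_append_left (by omega)]
  simp

namespace Pathograph

variable {H : Pathograph.{u}} (o : H.Orientation)

/-- The conditions on the sequence `s` of neighbourhoods in `H.V` of the internal vertices of the
path that replaces `p`. -/
structure IsPathNbhds (p : H.U) (n : ℕ) (s : Fin n → Set H.V) : Prop where
  pos : 0 < n
  left : ∀ j, o.left p ∈ s j ↔ j.val = 0
  right : ∀ j, o.right p ∈ s j ↔ j.val + 1 = n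
  spoke : ∀ v, H.spoke v p → ∃ j, v ∈ s j
  not_spoke : ∀ v, ¬ H.spoke v p → v ∉ H.ends p → ∀ j, v ∉ s j

variable {o}

theorem Realization.adj_path (R : H.Realization o) (p : H.U) (k l : Fin (R.len p)) :
    R.graph.Adj (.inr ⟨p, k⟩) (.inr ⟨p, l⟩) ↔ k.val + 1 = l.val ∨ l.val + 1 = k.val := by
  have := R.induced_path p k.castSucc.succ l.castSucc.succ
  simpa [SimpleGraph.pathGraph_adj] using this

theorem Realization.isPathNbhds (R : H.Realization o) (p : H.U) :
    IsPathNbhds o p (R.len p) fun j => R.nbhd (.inr ⟨p, j⟩) where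
  pos := R.one_le_len p
  left j := by
    have := R.induced_path p j.castSucc.succ 0
    change R.graph.Adj _ _ ↔ _
    simpa [SimpleGraph.pathGraph_adj] using this
  right j := by
    have := R.induced_path p j.castSucc.succ (Fin.last _)
    have hj := j.2
    simp only [pathSeq_last, pathSeq_castSucc_succ, SimpleGraph.pathGraph_adj, Fin.val_succ,
      Fin.val_castSucc, Fin.val_last] at this
    refine this.trans ?_
    omega
  spoke v hv := by
    obtain ⟨k, hk⟩ := R.adj_of_spoke v p hv
    exact ⟨k, hk.symm⟩
  not_spoke v hv hv' j hj := R.not_adj_of_not_spoke v p hv hv' j hj.symm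

/-- The realization of a pathograph without rungs in which the internal vertices of the paths have
prescribed neighbourhoods in `H.V`. -/
def realizationOfNbhds (hH : ∀ p q : H.U, ¬ H.rung.Adj p q) (n : H.U → ℕ)
    (s : ∀ p, Fin (n p) → Set H.V) (hs : ∀ p, IsPathNbhds o p (n p) (s p)) : H.Realization o where
  len := n
  one_le_len p := (hs p).pos
  graph :=
    { Adj
        | .inl v, .inl v' => H.edge.Adj v v'
        | .inl v, .inr z => v ∈ s z.1 z.2
        | .inr z, .inl v => v ∈ s z.1 z.2
        | .inr z, .inr z' => z.1 = z'.1 ∧ (z.2.val + 1 = z'.2.val ∨ z'.2.val + 1 = z.2.val)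
      symm := ⟨by
        rintro (v | i) (v' | j) h
        · exact SimpleGraph.Adj.symm h
        · exact h
        · exact h
        · exact ⟨h.1.symm, h.2.symm⟩⟩
      loopless := ⟨by
        rintro (v | i) h
        · exact H.edge.irrefl h
        · obtain ⟨-, h | h⟩ := h <;> omega⟩ }
  adj_vertex _ _ := Iff.rfl
  induced_path p := by
    have hn := o.not_adj p
    have hl := (hs p).left
    have hr := (hs p).right
    have hn' : ¬ H.edge.Adj (o.right p) (o.left p) := fun h => hn h.symm
    simp only [Fin.forall_fin_add_two, pathSeq_zero, pathSeq_last, pathSeq_castSucc_succ,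
      SimpleGraph.pathGraph_adj, Fin.val_succ, Fin.val_castSucc, Fin.val_last, Fin.val_zero]
    have hpos := (hs p).pos
    refine ⟨⟨?_, ?_, fun k => (hl k).trans ?_⟩, ⟨?_, ?_, fun k => (hr k).trans ?_⟩,
      fun k => ⟨(hl k).trans ?_, (hr k).trans ?_, fun l => (and_iff_right trivial).trans ?_⟩⟩
    · simp
    · simp only [hn, false_iff]
      omega
    · omega
    · simp only [hn', false_iff]
      omega
    · simp
    · omega
    · omega
    · omega
    · omega
  adj_of_spoke v p hv := (hs p).spoke v hv
  not_adj_of_not_spoke v p hv hv' := (hs p).not_spoke v hv hv'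
  adj_of_rung p q h := absurd h (hH p q)
  not_adj_of_not_rung _ _ hpq _ _ _ h := hpq h.1

variable {K : ℕ} (e : Fin K ≃ H.U)

/-- The words that occur as the block of the `i`-th urpath in a determination string. -/
theorem recognizable_isPathNbhds (o : H.Orientation) (i : Fin K) :
    Recognizable fun n (w : Fin n → Fin K × Set H.V) =>
      (∀ j, (w j).1 = i) ∧ IsPathNbhds o (e i) n fun j => (w j).2 := by
  have := H.finite_V
  have h₁ := Recognizable.exists_letter fun _ : Fin K × Set H.V => True
  have h₂ := (Recognizable.exists_letter fun c : Fin K × Set H.V => ¬ c.1 = i).not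
  have h₃ := (Recognizable.exists_first fun c : Fin K × Set H.V => ¬ o.left (e i) ∈ c.2).not
  have h₄ := (Recognizable.exists_consecutive fun c d : Fin K × Set H.V => o.left (e i) ∈ d.2).not
  have h₅ := (Recognizable.exists_last fun c : Fin K × Set H.V => ¬ o.right (e i) ∈ c.2).not
  have h₆ := (Recognizable.exists_consecutive fun c d : Fin K × Set H.V => o.right (e i) ∈ c.2).not
  have h₇ := Recognizable.forall_finite fun v => (Recognizable.const (H.spoke v (e i))).imp
    (Recognizable.exists_letter fun c : Fin K × Set H.V => v ∈ c.2)
  have h₈ := Recognizable.forall_finite fun v => (Recognizable.const (¬ H.spoke v (e i))).imp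
    ((Recognizable.const (v ∉ H.ends (e i))).imp
      (Recognizable.exists_letter fun c : Fin K × Set H.V => v ∈ c.2).not)
  refine (h₁.and (h₂.and (h₃.and (h₄.and (h₅.and (h₆.and (h₇.and h₈))))))).of_iff fun n w => ?_
  constructor
  · rintro ⟨hi, hpos, hl, hr, hs, hs'⟩
    refine ⟨⟨⟨0, hpos⟩, trivial⟩, fun ⟨j, hj⟩ => hj (hi j), ?_, ?_, ?_, ?_, hs, ?_⟩
    · rintro ⟨j, hj, h⟩
      exact h ((hl j).2 hj)
    · rintro ⟨j, j', hj, h⟩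
      have := (hl j').1 h
      omega
    · rintro ⟨j, hj, h⟩
      exact h ((hr j).2 hj)
    · rintro ⟨j, j', hj, h⟩
      have := (hr j).1 h
      omega
    · rintro v hv hv' ⟨j, hj⟩
      exact hs' v hv hv' j hj
  · rintro ⟨⟨j₀, -⟩, hi, hl, hl', hr, hr', hs, hs'⟩
    refine ⟨fun j => by_contra fun h => hi ⟨j, h⟩, j₀.pos, fun j => ⟨fun h => ?_, fun h => ?_⟩,
      fun j => ⟨fun h => ?_, fun h => ?_⟩, hs, fun v hv hv' j hj => hs' v hv hv' ⟨j, hj⟩⟩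
    · by_contra h0
      exact hl' ⟨⟨j - 1, by omega⟩, j, Nat.succ_pred h0, h⟩
    · exact by_contra fun h' => hl ⟨j, h, h'⟩
    · by_contra h0
      exact hr' ⟨j, ⟨j + 1, by omega⟩, rfl, h⟩
    · exact by_contra fun h' => hr ⟨j, h, h'⟩

/-- The determination strings are the concatenations of one block for each urpath, the conditions
on the blocks being independent of each other in the absence of rungs. -/
theorem isRegular_determinationString (hH : ∀ p q : H.U, ¬ H.rung.Adj p q) :
    Language.IsRegular ({x | ∃ R : H.Realization o, R.determinationString e = x} :
      Language (Fin K × Set H.V)) := by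
  refine (Language.isRegular_flatten_ofFn _ (recognizable_isPathNbhds e o)).of_mem_iff fun x => ?_
  constructor
  · rintro ⟨R, rfl⟩
    refine ⟨_, fun i => ?_, rfl⟩
    exact (wordProperty_ofFn (fun n (w : Fin n → Fin K × Set H.V) =>
      (∀ j, (w j).1 = i) ∧ IsPathNbhds o (e i) n fun j => (w j).2) _).2
        ⟨fun _ => rfl, R.isPathNbhds (e i)⟩
  · rintro ⟨b, hb, rfl⟩
    have hblock : ∀ p : H.U, ∃ (n : ℕ) (s : Fin n → Set H.V),
        b (e.symm p) = List.ofFn (fun j => (e.symm p, s j)) ∧ IsPathNbhds o p n s := by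
      intro p
      obtain ⟨i, rfl⟩ := e.surjective p
      obtain ⟨hi, hs⟩ := hb i
      refine ⟨_, _, ?_, hs⟩
      rw [Equiv.symm_apply_apply]
      conv_lhs => rw [← List.ofFn_get (b i)]
      congr 1
      funext j
      exact Prod.ext (hi j) rfl
    choose n s hbs hs using hblock
    refine ⟨realizationOfNbhds hH n s hs, ?_⟩
    unfold Realization.determinationString
    congr 2
    funext i
    have := hbs (e i)
    rw [Equiv.symm_apply_apply] at this
    rw [this]
    rfl

/-- A realization of a pathograph without rungs is isomorphic to the graph that its determination
string encodes. -/
theorem Realization.nonempty_iso_wordGraph (hH : ∀ p q : H.U, ¬ H.rung.Adj p q)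
    (R : H.Realization o) :
    Nonempty (R.graph ≃g wordGraph H.edge (R.determinationString e).get) := by
  let L : List (List (Fin K × Set H.V)) := List.ofFn fun i : Fin K =>
    List.ofFn fun j : Fin (R.len (e i)) => (i, R.nbhd (.inr ⟨e i, j⟩))
  let off : H.U → ℕ := fun p => ((L.take (e.symm p)).map List.length).sum
  have hget : ∀ z : Σ p : H.U, Fin (R.len p),
      ∃ h : off z.1 + z.2 < (R.determinationString e).length,
        (R.determinationString e)[off z.1 + z.2] = (e.symm z.1, R.nbhd (.inr z)) := by
    rintro ⟨p, k⟩
    obtain ⟨i, rfl⟩ := e.surjective p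
    obtain ⟨h, h'⟩ := List.getElem_flatten_offset L i (by simp [L]) k (by simp [L])
    simp only [off, Equiv.symm_apply_apply]
    refine ⟨h, h'.trans ?_⟩
    simp [L]
  choose hlt hpos using hget
  -- `ψ` sends an internal vertex to its position. It is injective because the letter at the
  -- position names the urpath, and then bijective by counting.
  let ψ : (Σ p : H.U, Fin (R.len p)) → Fin (R.determinationString e).length :=
    fun z => ⟨off z.1 + z.2, hlt z⟩
  have hψ : ∀ z, (R.determinationString e).get (ψ z) = (e.symm z.1, R.nbhd (.inr z)) := hpos
  have hinj : Function.Injective ψ := by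
    rintro ⟨p, k⟩ ⟨q, l⟩ h
    have h₁ := hψ ⟨p, k⟩
    rw [h, hψ] at h₁
    obtain rfl : q = p := e.symm.injective (congrArg Prod.fst h₁)
    have h₂ := congrArg Fin.val h
    simp only [ψ, add_right_inj] at h₂
    rw [Fin.ext h₂]
  have := H.finite_U
  have := Fintype.ofFinite H.U
  have hbij : Function.Bijective ψ := by
    refine (Fintype.bijective_iff_injective_and_card ψ).2 ⟨hinj, ?_⟩
    rw [Fintype.card_sigma, Fintype.card_fin, Realization.determinationString, List.length_flatten,
      List.map_ofFn, List.sum_ofFn]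
    simp [Equiv.sum_comp e R.len]
  refine ⟨⟨Equiv.sumCongr (Equiv.refl _) (Equiv.ofBijective ψ hbij), ?_⟩⟩
  rintro (v | ⟨p, k⟩) (v' | ⟨q, l⟩)
  · exact (R.adj_vertex v v').symm
  · change v ∈ ((R.determinationString e).get (ψ ⟨q, l⟩)).2 ↔ _
    rw [hψ]
    exact R.graph.adj_comm _ _
  · change v' ∈ ((R.determinationString e).get (ψ ⟨p, k⟩)).2 ↔ _
    rw [hψ]
    exact Iff.rfl
  · change ((ψ ⟨p, k⟩).val + 1 = (ψ ⟨q, l⟩).val ∨ (ψ ⟨q, l⟩).val + 1 = (ψ ⟨p, k⟩).val) ∧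
      ((R.determinationString e).get (ψ ⟨p, k⟩)).1 =
        ((R.determinationString e).get (ψ ⟨q, l⟩)).1 ↔ _
    rw [hψ, hψ]
    by_cases hpq : p = q
    · subst hpq
      rw [R.adj_path]
      simp only [ψ, and_true]
      omega
    · simp [hpq, R.not_adj_of_not_rung p q hpq (hH p q) k l]

theorem isFree_congr {𝓕 : Set Pathograph.{w}} {W W' : Type u} {G : SimpleGraph W}
    {G' : SimpleGraph W'} (φ : G ≃g G') : IsFree 𝓕 G ↔ IsFree 𝓕 G' := by
  refine forall₂_congr fun F _ => not_congr (exists₂_congr fun o R => ?_)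
  exact ⟨fun ⟨f⟩ => ⟨φ.toEmbedding.comp f⟩, fun ⟨f⟩ => ⟨φ.symm.toEmbedding.comp f⟩⟩

end Pathograph

theorem mainTheorem4 (H : Pathograph.{u}) (hH : ∀ p q : H.U, ¬ H.rung.Adj p q)
    (o : H.Orientation) (K : ℕ) (e : Fin K ≃ H.U)
    (𝓕 : Set Pathograph.{w}) (h𝓕 : 𝓕.Finite) :
    ∃ (Q : Type) (_ : Finite Q) (M : DFA (Fin K × Set H.V) Q),
      ∀ σ : List (Fin K × Set H.V),
        σ ∈ M.accepts ↔
          ∃ R : H.Realization o,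
            Pathograph.IsFree 𝓕 R.graph ∧ R.determinationString e = σ := by
  have := H.finite_V
  obtain ⟨Q, _, M, hM⟩ := (Pathograph.isRegular_determinationString (o := o) e hH).inf
    (Recognizable.isFree (ι := Fin K) H.edge h𝓕)
  refine ⟨Q, inferInstance, M, fun σ => ?_⟩
  rw [hM]
  constructor
  · rintro ⟨⟨R, rfl⟩, hfree⟩
    obtain ⟨φ⟩ := R.nonempty_iso_wordGraph e hH
    exact ⟨R, (Pathograph.isFree_congr φ).2 hfree, rfl⟩
  · rintro ⟨R, hfree, rfl⟩
    obtain ⟨φ⟩ := R.nonempty_iso_wordGraph e hH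
    exact ⟨⟨R, rfl⟩, (Pathograph.isFree_congr φ).1 hfree⟩
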